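/- Let $\mathcal X,\mathcal U,\mathcal Y$ be complex Hilbert spaces and let $\begin{bmatrix}A\&B\\ C\&D\end{bmatrix}$ be a system node on $(\mathcal X,\mathcal U,\mathcal Y)$. That is: $A\&B:\mathcal X\times\mathcal U\supset\operatorname{dom}(A\&B)\to\mathcal X$ is a closed linear operator; $C\&D:\operatorname{dom}(A\&B)\to\mathcal Y$ is linear and bounded with respect to the graph norm $$\Big\|\begin{pmatrix}x\\u\end{pmatrix}\Big\|_{\operatorname{dom}(A\&B)}=\Big(\|x\|_{\mathcal X}^2+\|u\|_{\mathcal U}^2+\Big\|A\&B\begin{pmatrix}x\\u\end{pmatrix}\Big\|_{\mathcal X}^2\Big)^{1/2};$$ for every $u\in\mathcal U$ there is some $x\in\mathcal X$ with $\begin{pmatrix}x\\u\end{pmatrix}\in\operatorname{dom}(A\&B)$; and the main operator $Ax=A\&B\begin{pmatrix}x\\0\end{pmatrix}$, with domain $\{x\in\mathcal X:\begin{pmatrix}x\\0\end{pmatrix}\in\operatorname{dom}(A\&B)\}$, generates a strongly continuous semigroup on $\mathcal X$. A classical trajectory on $[0,T]$ is a triple $(x,u,y)\in C^1([0,T];\mathcal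 X)\times C([0,T];\mathcal U)\times C([0,T];\mathcal Y)$ such that, for all $t\in[0,T]$, $\begin{pmatrix}x(t)\\u(t)\end{pmatrix}\in\operatorname{dom}(A\&B)$, $\dot x(t)=A\&B\begin{pmatrix}x(t)\\u(t)\end{pmatrix}$ and $y(t)=C\&D\begin{pmatrix}x(t)\\u(t)\end{pmatrix}$. Let $Q=Q^*\in L(\mathcal Y)$, $S\in L(\mathcal U,\mathcal Y)$, $R=R^*\in L(\mathcal U)$, and let $$s(y,u)=\Big\langle\begin{pmatrix}y\\u\end{pmatrix},\begin{bmatrix}Q&S\\S^*&R\end{bmatrix}\begin{pmatrix}y\\u\end{pmatrix}\Big\rangle_{\mathcal Y\times\mathcal U}.$$ Let $\mathcal S:\mathcal X\supset\operatorname{dom}(\mathcal S)\to\mathbb R$ be a semi-bounded, closed and densely defined real quadratic form, where these notions mean the following. The set $\operatorname{dom}(\mathcal S)$ is a dense linear subspace of $\mathcal X$, $\mathcal S(0)=0$, and $$h(x,z)=\tfrac14\big(\mathcal S(x+z)-\mathcal S(x-z)+i\,\mathcal S(x+iz)-i\,\mathcal S(x-iz)\big)$$ is a sesquilinear form on $\operatorname{dom}(\mathcal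 S)$. For some sign $\sigma\in\{1,-1\}$ and some $\lambda_0\ge0$, $x\mapsto(\sigma\mathcal S(x)+\lambda_0\|x\|_{\mathcal X}^2)^{1/2}$ is a norm on $\operatorname{dom}(\mathcal S)$ (semi-boundedness), and, for some such $\sigma$ and $\lambda_0$ and some $\lambda>\lambda_0$, $\operatorname{dom}(\mathcal S)$ is complete with respect to the norm $x\mapsto(\sigma\mathcal S(x)+\lambda\|x\|_{\mathcal X}^2)^{1/2}$ (closedness). Assume that the system is dissipative with respect to the supply rate functional $s$ and storage function $\mathcal S$: for every $T>0$ and every classical trajectory $(x,u,y)$ on $[0,T]$ one has $x(0),x(T)\in\operatorname{dom}(\mathcal S)$ and $$\mathcal S(x(T))-\mathcal S(x(0))+\int_0^Ts\big(y(t),u(t)\big)\,dt\ge0.$$ Let $\mathcal V=\{x\in\mathcal X:\exists\,u\in\mathcal U\text{ with }\begin{pmatrix}x\\u\end{pmatrix}\in\operatorname{dom}(A\&B)\}$, with the norm $$\|x\|_{\mathcal V}=\inf\Big\{\Big\|\begin{pmatrix}x\\u\end{pmatrix}\Big\|_{\operatorname{dom}(A\&B)}: u\in\mathcal U,\ \begin{pmatrix}x\\u\end{pmatrix}\in\operatorname{dom}(A\&B)\Big\}.$$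 Then $\mathcal V\subset\operatorname{dom}(\mathcal S)$, and there exists a constant $c>0$ such that $|\mathcal S(x_0)|\le c\,\|x_0\|_{\mathcal V}^2$ for all $x_0\in\mathcal V$. -/

import Mathlib

open Set Filter Topology
open scoped NNReal

noncomputable section

/-! ### Strongly continuous semigroups -/

/-- A strongly continuous semigroup of bounded linear operators on `X`. -/
structure C0Semigroup (X : Type*) [NormedAddCommGroup X] [NormedSpace ℂ X] where
  op : ℝ≥0 → X →L[ℂ] X
  op_zero : op 0 = ContinuousLinearMap.id ℂ X
  op_add : ∀ s t : ℝ≥0, op (s + t) = (op s).comp (op t)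
  continuous_orbit : ∀ x : X, Continuous fun t : ℝ≥0 => op t x

/-- The (unbounded) operator `A` is the generator of the semigroup `G`: we have `x ∈ dom A` and
`A x = z` if and only if `(G h x - x) / h` tends to `z` as `h ↓ 0`. In particular `dom A` is the
set of all `x` for which this limit exists. -/
def IsGenerator {X : Type*} [NormedAddCommGroup X] [NormedSpace ℂ X]
    (A : X →ₗ.[ℂ] X) (G : C0Semigroup X) : Prop :=
  ∀ x z : X, (∃ hx : x ∈ A.domain, A ⟨x, hx⟩ = z) ↔
    Tendsto (fun h : ℝ≥0 => ((h : ℝ)⁻¹ : ℂ) • (G.op h x - x)) (𝓝[>] 0) (𝓝 z)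

/-! ### System nodes and their classical trajectories -/

/-- The main operator of `A&B`: its domain is `{x | (x, 0) ∈ dom (A&B)}`, and `A x = A&B (x, 0)`. -/
def mainOperator {X U : Type*} [NormedAddCommGroup X] [NormedSpace ℂ X]
    [NormedAddCommGroup U] [NormedSpace ℂ U] (AB : X × U →ₗ.[ℂ] X) : X →ₗ.[ℂ] X where
  domain := AB.domain.comap (LinearMap.inl ℂ X U)
  toFun := AB.toFun ∘ₗ (LinearMap.inl ℂ X U).submoduleComap AB.domain

/-- The graph norm `(‖x‖² + ‖u‖² + ‖A&B (x, u)‖²)^(1/2)` of `(x, u) ∈ dom (A&B)`, where `X × U`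
carries the Hilbert space norm `(‖x‖² + ‖u‖²)^(1/2)`. -/
def graphNorm {X U : Type*} [NormedAddCommGroup X] [NormedSpace ℂ X]
    [NormedAddCommGroup U] [NormedSpace ℂ U] (AB : X × U →ₗ.[ℂ] X) (z : AB.domain) : ℝ :=
  √(‖(z : X × U).1‖ ^ 2 + ‖(z : X × U).2‖ ^ 2 + ‖AB z‖ ^ 2)

/-- A system node on the triple `(X, U, Y)`. -/
structure SystemNode (X U Y : Type*)
    [NormedAddCommGroup X] [InnerProductSpace ℂ X] [CompleteSpace X]
    [NormedAddCommGroup U] [InnerProductSpace ℂ U] [CompleteSpace U]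
    [NormedAddCommGroup Y] [InnerProductSpace ℂ Y] [CompleteSpace Y] where
  /-- the operator `A&B` with its domain -/
  AB : X × U →ₗ.[ℂ] X
  /-- the operator `C&D`, which has the same domain as `A&B` -/
  CD : AB.domain →ₗ[ℂ] Y
  closed_AB : AB.IsClosed
  bounded_CD : ∃ K : ℝ, ∀ z : AB.domain, ‖CD z‖ ≤ K * graphNorm AB z
  exists_state : ∀ u : U, ∃ x : X, (x, u) ∈ AB.domain
  generates : ∃ G : C0Semigroup X, IsGenerator (mainOperator AB) G

namespace SystemNode

variable {X U Y : Type*}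
  [NormedAddCommGroup X] [InnerProductSpace ℂ X] [CompleteSpace X]
  [NormedAddCommGroup U] [InnerProductSpace ℂ U] [CompleteSpace U]
  [NormedAddCommGroup Y] [InnerProductSpace ℂ Y] [CompleteSpace Y]

/-- `(x(·), u(·), y(·))` is a classical trajectory on `[0, T]` (only the values on `[0, T]` matter;
at the end points the derivative is one-sided). -/
structure IsClassicalTrajectory (N : SystemNode X U Y) (T : ℝ)
    (x : ℝ → X) (u : ℝ → U) (y : ℝ → Y) : Prop where
  contDiffOn_x : ContDiffOn ℝ 1 x (Icc 0 T)
  continuousOn_u : ContinuousOn u (Icc 0 T)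
  continuousOn_y : ContinuousOn y (Icc 0 T)
  eqn : ∀ t ∈ Icc (0 : ℝ) T, ∃ h : (x t, u t) ∈ N.AB.domain,
    HasDerivWithinAt x (N.AB ⟨(x t, u t), h⟩) (Icc 0 T) t ∧ y t = N.CD ⟨(x t, u t), h⟩

/-- The space `V` of all `x` for which there is some `u` with `(x, u) ∈ dom (A&B)`. -/
def V (N : SystemNode X U Y) : Set X :=
  {x | ∃ u : U, (x, u) ∈ N.AB.domain}

/-- The norm of `V`: the infimum of the graph norms of all `(x, u) ∈ dom (A&B)`. -/
def normV (N : SystemNode X U Y) (x : X) : ℝ :=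
  sInf {r : ℝ | ∃ (u : U) (h : (x, u) ∈ N.AB.domain), r = graphNorm N.AB ⟨(x, u), h⟩}

end SystemNode

/-! ### Supply rates -/

/-- The supply rate `s(y, u) = ⟨(y, u), (Q y + S u, S* y + R u)⟩` with the inner product of the
Hilbert space `Y × U`. For self-adjoint `Q` and `R` this number is real. -/
def supplyRate {U Y : Type*}
    [NormedAddCommGroup U] [InnerProductSpace ℂ U] [CompleteSpace U]
    [NormedAddCommGroup Y] [InnerProductSpace ℂ Y] [CompleteSpace Y]
    (Q : Y →L[ℂ] Y) (S : U →L[ℂ] Y) (R : U →L[ℂ] U) (y : Y) (u : U) : ℝ :=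
  (inner ℂ y (Q y + S u) + inner ℂ u (ContinuousLinearMap.adjoint S y + R u)).re

/-! ### Real quadratic forms -/

/-- The polarization
`h(x, z) = (S(x + z) - S(x - z) + i S(x + i z) - i S(x - i z)) / 4` of a real function `S`. -/
def polarization {D : Type*} [AddCommGroup D] [Module ℂ D] (S : D → ℝ) (x z : D) : ℂ :=
  (1 / 4 : ℂ) * ((S (x + z) : ℂ) - (S (x - z) : ℂ)
    + Complex.I * (S (x + Complex.I • z) : ℂ) - Complex.I * (S (x - Complex.I • z) : ℂ))

/-- A real quadratic form defined on a subspace of `X`: its polarization is a sesquilinear form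
(linear in the first argument, conjugate linear in the second one), and it vanishes at `0`. -/
structure RealQuadraticForm (X : Type*) [NormedAddCommGroup X] [NormedSpace ℂ X] where
  dom : Submodule ℂ X
  toFun : dom → ℝ
  map_zero : toFun 0 = 0
  polar_add_left : ∀ x x' z : dom,
    polarization toFun (x + x') z = polarization toFun x z + polarization toFun x' z
  polar_smul_left : ∀ (a : ℂ) (x z : dom),
    polarization toFun (a • x) z = a * polarization toFun x z
  polar_add_right : ∀ x z z' : dom,
    polarization toFun x (z + z') = polarization toFun x z + polarization toFun x z'
  polar_smul_right : ∀ (a : ℂ) (x z : dom),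
    polarization toFun x (a • z) = (starRingEnd ℂ) a * polarization toFun x z

namespace RealQuadraticForm

variable {X : Type*} [NormedAddCommGroup X] [NormedSpace ℂ X]

/-- The form is densely defined. -/
def IsDenselyDefined (S : RealQuadraticForm X) : Prop :=
  Dense (S.dom : Set X)

/-- The function `x ↦ (σ S(x) + lam ‖x‖²)^(1/2)` on the domain of the form. -/
def formNorm (S : RealQuadraticForm X) (σ lam : ℝ) (x : S.dom) : ℝ :=
  √(σ * S.toFun x + lam * ‖(x : X)‖ ^ 2)

/-- The function `x ↦ (σ S(x) + lam ‖x‖²)^(1/2)` is (well defined and) a norm on the domain. -/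
structure IsFormNorm (S : RealQuadraticForm X) (σ lam : ℝ) : Prop where
  radicand_nonneg : ∀ x : S.dom, 0 ≤ σ * S.toFun x + lam * ‖(x : X)‖ ^ 2
  eq_zero : ∀ x : S.dom, S.formNorm σ lam x = 0 → x = 0
  smul : ∀ (a : ℂ) (x : S.dom), S.formNorm σ lam (a • x) = ‖a‖ * S.formNorm σ lam x
  triangle : ∀ x z : S.dom, S.formNorm σ lam (x + z) ≤ S.formNorm σ lam x + S.formNorm σ lam z

/-- Every sequence in the domain that is Cauchy with respect to `(σ S(x) + lam ‖x‖²)^(1/2)`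
converges with respect to it to an element of the domain. -/
def IsFormComplete (S : RealQuadraticForm X) (σ lam : ℝ) : Prop :=
  ∀ f : ℕ → S.dom,
    (∀ ε > 0, ∃ n₀ : ℕ, ∀ m ≥ n₀, ∀ n ≥ n₀, S.formNorm σ lam (f m - f n) < ε) →
      ∃ x : S.dom, Tendsto (fun n => S.formNorm σ lam (f n - x)) atTop (𝓝 0)

/-- The form is semi-bounded. -/
def IsSemiBounded (S : RealQuadraticForm X) : Prop :=
  ∃ σ : ℝ, (σ = 1 ∨ σ = -1) ∧ ∃ lam : ℝ, 0 ≤ lam ∧ S.IsFormNorm σ lam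

/-- The (semi-bounded) form is closed: its domain is complete with respect to
`(σ S(x) + lam ‖x‖²)^(1/2)` for some `lam` that is strictly larger than an admissible one. As usual,
the strict inequality makes the norm dominate a multiple of the norm of `X`; up to equivalence the
norm then does not depend on `lam`. -/
def IsClosedForm (S : RealQuadraticForm X) : Prop :=
  ∃ σ : ℝ, (σ = 1 ∨ σ = -1) ∧ ∃ lam₀ : ℝ, 0 ≤ lam₀ ∧ S.IsFormNorm σ lam₀ ∧
    ∃ lam : ℝ, lam₀ < lam ∧ S.IsFormComplete σ lam

end RealQuadraticForm

/-! ### Dissipativity -/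

/-- The system given by the node `N` is dissipative with respect to the supply rate functional
`s` and storage function `S`: for every classical trajectory on `[0, T]`, `T > 0`, we have
`x(0), x(T) ∈ dom S` and the dissipation inequality holds. -/
def SystemNode.IsDissipative {X U Y : Type*}
    [NormedAddCommGroup X] [InnerProductSpace ℂ X] [CompleteSpace X]
    [NormedAddCommGroup U] [InnerProductSpace ℂ U] [CompleteSpace U]
    [NormedAddCommGroup Y] [InnerProductSpace ℂ Y] [CompleteSpace Y]
    (N : SystemNode X U Y) (s : Y → U → ℝ) (S : RealQuadraticForm X) : Prop :=
  ∀ T : ℝ, 0 < T → ∀ (x : ℝ → X) (u : ℝ → U) (y : ℝ → Y), N.IsClassicalTrajectory T x u y →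
    ∃ (h0 : x 0 ∈ S.dom) (hT : x T ∈ S.dom),
      0 ≤ S.toFun ⟨x T, hT⟩ - S.toFun ⟨x 0, h0⟩ + ∫ t in (0 : ℝ)..T, s (y t) (u t)

end

/-! Given `(x₀, u₀)` in the domain of `A&B`, put `z = A&B (x₀, u₀)` and let `G` be the semigroup of
the main operator. With constant input `u₀`, the state `x t = x₀ + ∫₀ᵗ G(s) z ds` is a classical
trajectory from `x₀`, so dissipativity puts `x₀` in the form domain. The bound is then automatic.
The graph of `A&B` is a Banach space, its projection to the state takes values in the form domain,
and that domain is itself a Banach space continuously embedded in `X`. By the closed graph theorem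
(`exists_abs_toFun_le`) the projection is bounded for the form norm; taking the infimum over inputs
gives the norm of `V`. -/

open MeasureTheory

/-! ### Integrated semigroup orbits -/

namespace C0Semigroup

variable {X : Type*} [NormedAddCommGroup X] [NormedSpace ℂ X]

/-- The orbit of `z`, extended to the negative half-axis by the constant `z`. -/
def orbit (G : C0Semigroup X) (z : X) (s : ℝ) : X := G.op s.toNNReal z

theorem continuous_orbit_extended (G : C0Semigroup X) (z : X) : Continuous (G.orbit z) :=
  (G.continuous_orbit z).comp continuous_real_toNNReal

theorem orbit_zero (G : C0Semigroup X) (z : X) : G.orbit z 0 = z := by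
  simp [orbit, G.op_zero]

theorem op_orbit (G : C0Semigroup X) (z : X) (h : ℝ≥0) {s : ℝ} (hs : 0 ≤ s) :
    G.op h (G.orbit z s) = G.orbit z (s + h) := by
  simp only [orbit]
  have hadd : (s + (h : ℝ)).toNNReal = h + s.toNNReal := by
    rw [Real.toNNReal_add hs h.coe_nonneg, Real.toNNReal_coe, add_comm]
  rw [hadd, G.op_add]
  rfl

/-- The primitive of the orbit of `z` that vanishes at `0`. -/
noncomputable def orbitIntegral (G : C0Semigroup X) (z : X) (t : ℝ) : X :=
  ∫ s in (0 : ℝ)..t, G.orbit z s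

theorem orbitIntegral_zero (G : C0Semigroup X) (z : X) : G.orbitIntegral z 0 = 0 := by
  simp [orbitIntegral]

variable [CompleteSpace X]

theorem hasDerivAt_orbitIntegral (G : C0Semigroup X) (z : X) (t : ℝ) :
    HasDerivAt (G.orbitIntegral z) (G.orbit z t) t :=
  intervalIntegral.integral_hasDerivAt_right
    ((G.continuous_orbit_extended z).intervalIntegrable _ _)
    ((G.continuous_orbit_extended z).stronglyMeasurableAtFilter _ _)
    (G.continuous_orbit_extended z).continuousAt

theorem op_orbitIntegral (G : C0Semigroup X) (z : X) (h : ℝ≥0) {t : ℝ} (ht : 0 ≤ t) :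
    G.op h (G.orbitIntegral z t) = G.orbitIntegral z (t + h) - G.orbitIntegral z h := by
  have hi : ∀ a b : ℝ, IntervalIntegrable (G.orbit z) volume a b :=
    fun a b => (G.continuous_orbit_extended z).intervalIntegrable _ _
  unfold orbitIntegral
  rw [← ContinuousLinearMap.intervalIntegral_comp_comm (G.op h) (hi 0 t),
    intervalIntegral.integral_interval_sub_left (hi _ _) (hi _ _)]
  have := intervalIntegral.integral_comp_add_right (a := 0) (b := t) (G.orbit z) (h : ℝ)
  rw [zero_add] at this
  rw [← this]
  refine intervalIntegral.integral_congr fun s hs => ?_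
  rw [uIcc_of_le ht] at hs
  exact G.op_orbit z h hs.1

/-- Integrals of orbits belong to the domain of the generator. -/
theorem generator_orbitIntegral (G : C0Semigroup X) {A : X →ₗ.[ℂ] X} (hA : IsGenerator A G)
    (z : X) {t : ℝ} (ht : 0 ≤ t) :
    ∃ h : G.orbitIntegral z t ∈ A.domain,
      A ⟨G.orbitIntegral z t, h⟩ = G.orbit z t - z := by
  rw [hA]
  have hlim : Tendsto (fun h : ℝ≥0 => (h : ℝ)) (𝓝[>] 0) (𝓝[>] 0) := by
    refine tendsto_nhdsWithin_iff.2 ⟨?_, ?_⟩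
    · exact (NNReal.continuous_coe.tendsto' 0 0 rfl).mono_left nhdsWithin_le_nhds
    · filter_upwards [self_mem_nhdsWithin] with h hh
      exact NNReal.coe_pos.2 hh
  -- With `F = G.orbitIntegral z`, `G(h) F(t) - F(t) = (F(t+h) - F(t)) - (F(h) - F(0))`: a
  -- difference of slopes of `F` at `t` and at `0`.
  have key := fun s => ((G.hasDerivAt_orbitIntegral z s).tendsto_slope_zero_right).comp hlim
  have := (key t).sub (key 0)
  rw [orbit_zero] at this
  refine this.congr fun h => ?_
  simp only [Function.comp_apply, G.op_orbitIntegral z h ht, zero_add, orbitIntegral_zero, sub_zero]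
  rw [← smul_sub, ← Complex.ofReal_inv, Complex.coe_smul]
  congr 1
  abel

end C0Semigroup

/-! ### Graph norm and classical trajectories -/

theorem norm_le_graphNorm {X U : Type*} [NormedAddCommGroup X] [NormedSpace ℂ X]
    [NormedAddCommGroup U] [NormedSpace ℂ U] (AB : X × U →ₗ.[ℂ] X) (z : AB.domain) :
    ‖((z : X × U), AB z)‖ ≤ graphNorm AB z := by
  refine max_le (max_le ?_ ?_) ?_ <;> refine Real.le_sqrt_of_sq_le ?_ <;>
    nlinarith [sq_nonneg ‖(z : X × U).1‖, sq_nonneg ‖(z : X × U).2‖, sq_nonneg ‖AB z‖]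

namespace SystemNode

variable {X U Y : Type*}
  [NormedAddCommGroup X] [InnerProductSpace ℂ X] [CompleteSpace X]
  [NormedAddCommGroup U] [InnerProductSpace ℂ U] [CompleteSpace U]
  [NormedAddCommGroup Y] [InnerProductSpace ℂ Y] [CompleteSpace Y]

theorem continuous_CD_comp (N : SystemNode X U Y) {α : Type*} [TopologicalSpace α]
    {f : α → N.AB.domain} (hf : Continuous fun t => (f t : X × U))
    (hAB : Continuous fun t => N.AB (f t)) : Continuous fun t => N.CD (f t) := by
  obtain ⟨K, hK⟩ := N.bounded_CD
  rw [continuous_iff_continuousAt]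
  intro t
  have hg : Tendsto (fun s => K * graphNorm N.AB (f s - f t)) (𝓝 t) (𝓝 0) := by
    have hc : Continuous fun s => K * graphNorm N.AB (f s - f t) := by
      simp only [graphNorm, Submodule.coe_sub, Prod.fst_sub, Prod.snd_sub, N.AB.map_sub]
      fun_prop
    refine hc.tendsto' t 0 ?_
    simp [graphNorm]
  refine tendsto_iff_norm_sub_tendsto_zero.2 (squeeze_zero (fun _ => norm_nonneg _) (fun s => ?_) hg)
  rw [← map_sub]
  exact hK _

/-- Every `(x₀, u₀) ∈ dom (A&B)` is the initial value of a classical trajectory with the constant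
input `u₀`. -/
theorem exists_isClassicalTrajectory (N : SystemNode X U Y) {x₀ : X} {u₀ : U}
    (h₀ : (x₀, u₀) ∈ N.AB.domain) (T : ℝ) :
    ∃ (x : ℝ → X) (u : ℝ → U) (y : ℝ → Y), N.IsClassicalTrajectory T x u y ∧ x 0 = x₀ := by
  obtain ⟨G, hG⟩ := N.generates
  set z := N.AB ⟨(x₀, u₀), h₀⟩ with hz
  -- Clamping time at `0` keeps the state in the domain for every real `t`, so the output can be
  -- defined on all of `ℝ`; on `[0, T]` nothing changes.
  let τ : ℝ → ℝ := fun t => max t 0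
  let x : ℝ → X := fun t => x₀ + G.orbitIntegral z t
  have hx : ∀ t, HasDerivAt x (G.orbit z t) t := fun t =>
    (G.hasDerivAt_orbitIntegral z t).const_add x₀
  have hxc : Continuous x := continuous_iff_continuousAt.2 fun t => (hx t).continuousAt
  have hmem : ∀ t : ℝ, 0 ≤ t → ∃ h : (x t, u₀) ∈ N.AB.domain,
      N.AB ⟨(x t, u₀), h⟩ = G.orbit z t := by
    intro t ht
    obtain ⟨h, hA⟩ := G.generator_orbitIntegral hG z ht
    have h' : (G.orbitIntegral z t, (0 : U)) ∈ N.AB.domain := h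
    have hA' : N.AB ⟨(G.orbitIntegral z t, (0 : U)), h'⟩ = G.orbit z t - z := hA
    -- The second summand lies in the domain of the main operator, and the values add up to `z +
    -- (G(t) z - z) = G(t) z`.
    have hsum : (x t, u₀) = (x₀, u₀) + (G.orbitIntegral z t, (0 : U)) := by simp [x]
    refine ⟨hsum ▸ N.AB.domain.add_mem h₀ h', ?_⟩
    have := N.AB.map_add ⟨(x₀, u₀), h₀⟩ ⟨(G.orbitIntegral z t, (0 : U)), h'⟩
    rw [hA', ← hz, add_sub_cancel] at this
    rw [← this]
    congr 1
    exact Subtype.ext hsum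
  choose hdom hAB using fun t => hmem (τ t) (le_max_right t 0)
  have hτ : Continuous τ := by fun_prop
  refine ⟨x, fun _ => u₀, fun t => N.CD ⟨(x (τ t), u₀), hdom t⟩, ⟨?_, ?_, ?_, ?_⟩, ?_⟩
  · refine (contDiff_one_iff_deriv.2 ⟨fun t => (hx t).differentiableAt, ?_⟩).contDiffOn
    rw [funext fun t => (hx t).deriv]
    exact G.continuous_orbit_extended z
  · exact continuousOn_const
  · refine (N.continuous_CD_comp ?_ ?_).continuousOn
    · exact (hxc.comp hτ).prodMk continuous_const
    · simp only [hAB]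
      exact (G.continuous_orbit_extended z).comp hτ
  · intro t ht
    obtain ⟨h, e⟩ := hmem t ht.1
    refine ⟨h, e ▸ (hx t).hasDerivWithinAt, ?_⟩
    simp only [τ, max_eq_left ht.1]
  · simp [x, G.orbitIntegral_zero]

end SystemNode

/-! ### The form domain as a Banach space -/

namespace RealQuadraticForm

variable {X : Type*} [NormedAddCommGroup X] [NormedSpace ℂ X]

/-- The form norm as a seminorm on the domain of the form. -/
noncomputable def IsFormNorm.toSeminorm {S : RealQuadraticForm X} {σ lam : ℝ}
    (h : S.IsFormNorm σ lam) : Seminorm ℂ S.dom :=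
  Seminorm.of (S.formNorm σ lam) h.triangle h.smul

/-- The domain of a form with the norm `‖x‖ + (σ S(x) + lam ‖x‖²)^(1/2)`. -/
def FormSpace {S : RealQuadraticForm X} {σ lam : ℝ} (_ : S.IsFormNorm σ lam) : Type _ := S.dom

namespace FormSpace

variable {S : RealQuadraticForm X} {σ lam : ℝ} (h : S.IsFormNorm σ lam)

/-- The norm of the domain of a form. -/
noncomputable def norm : Seminorm ℂ S.dom := normSeminorm ℂ S.dom + h.toSeminorm

theorem norm_def (x : S.dom) : norm h x = ‖(x : X)‖ + S.formNorm σ lam x := rfl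

noncomputable instance : NormedAddCommGroup (FormSpace h) :=
  AddGroupNorm.toNormedAddCommGroup (E := S.dom)
    { (norm h).toAddGroupSeminorm with
      eq_zero_of_map_eq_zero' := fun x hx => by
        have hx' : ‖(x : X)‖ + S.formNorm σ lam x = 0 := hx
        have : ‖(x : X)‖ = 0 :=
          le_antisymm (by linarith [Real.sqrt_nonneg (σ * S.toFun x + lam * ‖(x : X)‖ ^ 2),
            show S.formNorm σ lam x = √(σ * S.toFun x + lam * ‖(x : X)‖ ^ 2) from rfl])
            (norm_nonneg _)
        exact Subtype.ext (norm_eq_zero.1 this) }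

instance : Module ℂ (FormSpace h) := inferInstanceAs (Module ℂ S.dom)

theorem norm_eq (x : FormSpace h) :
    ‖x‖ = ‖((show S.dom from x : S.dom) : X)‖ + S.formNorm σ lam (show S.dom from x) := rfl

noncomputable instance : NormedSpace ℂ (FormSpace h) where
  norm_smul_le a x := (map_smul_eq_mul (norm h) a (show S.dom from x)).le

/-- The embedding of the domain of a form into the ambient space. -/
noncomputable def subtypeL : FormSpace h →L[ℂ] X :=
  LinearMap.mkContinuous (σ := RingHom.id ℂ) (E := FormSpace h) S.dom.subtype 1 fun x => by
    rw [one_mul, norm_eq]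
    exact le_add_of_nonneg_right (Real.sqrt_nonneg _)

theorem subtypeL_injective : Function.Injective (subtypeL h) := Subtype.val_injective

theorem abs_toFun_le (hσ : σ = 1 ∨ σ = -1) (hlam : 0 ≤ lam) (x : S.dom) :
    |S.toFun x| ≤ (1 + lam) * norm h x ^ 2 := by
  have hsq : S.formNorm σ lam x ^ 2 = σ * S.toFun x + lam * ‖(x : X)‖ ^ 2 :=
    Real.sq_sqrt (h.radicand_nonneg x)
  have h0 : 0 ≤ S.formNorm σ lam x := Real.sqrt_nonneg _
  have h1 := norm_nonneg (x : X)
  have h2 : S.formNorm σ lam x ^ 2 ≤ norm h x ^ 2 := by rw [norm_def]; gcongr; linarith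
  have h3 : lam * ‖(x : X)‖ ^ 2 ≤ lam * norm h x ^ 2 := by rw [norm_def]; gcongr; linarith
  have h4 := mul_nonneg hlam (sq_nonneg ‖(x : X)‖)
  rw [abs_le]
  rcases hσ with rfl | rfl <;> constructor <;>
    nlinarith [sq_nonneg (S.formNorm 1 lam x), sq_nonneg (S.formNorm (-1) lam x)]

theorem formNorm_le_formNorm {lam' : ℝ} (hl : lam ≤ lam') (x : S.dom) :
    S.formNorm σ lam x ≤ S.formNorm σ lam' x := by
  unfold formNorm
  gcongr

/-- Nonnegativity of the radicand at `lam` leaves `(lam' - lam) ‖x‖²` below the radicand at `lam'`;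
the strict inequality is what controls `‖x‖`. -/
theorem norm_le_formNorm {lam' : ℝ} (hl : lam < lam') (x : S.dom) :
    norm h x ≤ ((√(lam' - lam))⁻¹ + 1) * S.formNorm σ lam' x := by
  have hd : 0 < √(lam' - lam) := Real.sqrt_pos.2 (sub_pos.2 hl)
  have h1 : √(lam' - lam) * ‖(x : X)‖ ≤ S.formNorm σ lam' x := by
    refine Real.le_sqrt_of_sq_le ?_
    rw [mul_pow, Real.sq_sqrt (sub_pos.2 hl).le]
    nlinarith [h.radicand_nonneg x]
  have h2 : ‖(x : X)‖ ≤ (√(lam' - lam))⁻¹ * S.formNorm σ lam' x := by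
    rwa [inv_mul_eq_div, le_div_iff₀' hd]
  rw [norm_def, add_mul, one_mul]
  exact add_le_add h2 (formNorm_le_formNorm hl.le x)

theorem formNorm_le_norm {lam' : ℝ} (hl : lam ≤ lam') (x : S.dom) :
    S.formNorm σ lam' x ≤ (√(lam' - lam) + 1) * norm h x := by
  have h0 : 0 ≤ S.formNorm σ lam x := Real.sqrt_nonneg _
  have hsq : S.formNorm σ lam x ^ 2 = σ * S.toFun x + lam * ‖(x : X)‖ ^ 2 :=
    Real.sq_sqrt (h.radicand_nonneg x)
  have h1 := norm_nonneg (x : X)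
  have hd := Real.sqrt_nonneg (lam' - lam)
  have h2 : S.formNorm σ lam' x ≤ √(lam' - lam) * ‖(x : X)‖ + S.formNorm σ lam x := by
    refine Real.sqrt_le_iff.2 ⟨by positivity, ?_⟩
    have := Real.sq_sqrt (sub_nonneg.2 hl)
    have h3 := mul_nonneg (mul_nonneg hd h1) h0
    calc σ * S.toFun x + lam' * ‖(x : X)‖ ^ 2
        = √(lam' - lam) ^ 2 * ‖(x : X)‖ ^ 2 + S.formNorm σ lam x ^ 2 := by rw [this, hsq]; ring
      _ ≤ _ := by nlinarith
  rw [norm_def]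
  nlinarith [mul_nonneg hd h0]

/-- The two preceding estimates make `norm h` equivalent to the form norm at `lam'`, so completeness
transfers. -/
theorem completeSpace {lam' : ℝ} (hl : lam < lam') (hc : S.IsFormComplete σ lam') :
    CompleteSpace (FormSpace h) := by
  refine Metric.complete_of_cauchySeq_tendsto fun f hf => ?_
  have hC : 0 < √(lam' - lam) + 1 := by positivity
  obtain ⟨x, hx⟩ := hc f fun ε hε => by
    obtain ⟨n₀, hn⟩ := Metric.cauchySeq_iff.1 hf (ε / (√(lam' - lam) + 1)) (by positivity)
    refine ⟨n₀, fun m hm n hn' => (formNorm_le_norm h hl.le _).trans_lt ?_⟩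
    have := hn m hm n hn'
    rw [dist_eq_norm, lt_div_iff₀' hC] at this
    exact this
  refine ⟨x, tendsto_iff_norm_sub_tendsto_zero.2 ?_⟩
  have := hx.const_mul ((√(lam' - lam))⁻¹ + 1)
  rw [mul_zero] at this
  exact squeeze_zero (fun _ => norm_nonneg _) (fun n =>
    norm_le_formNorm h hl (show S.dom from f n - (show FormSpace h from x))) this

end FormSpace

/-- A bounded operator with values in the domain of a closed form is bounded with respect to the
form. -/
theorem IsClosedForm.exists_abs_toFun_le {S : RealQuadraticForm X} (hS : S.IsClosedForm)
    {E : Type*} [NormedAddCommGroup E] [NormedSpace ℂ E] [CompleteSpace E]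
    (f : E →L[ℂ] X) (hf : ∀ e, f e ∈ S.dom) :
    ∃ c : ℝ, 0 < c ∧ ∀ e, |S.toFun ⟨f e, hf e⟩| ≤ c * ‖e‖ ^ 2 := by
  obtain ⟨σ, hσ, lam, hlam, h, lam', hl, hc⟩ := hS
  have := FormSpace.completeSpace h hl hc
  let g : E →ₗ[ℂ] FormSpace h := f.toLinearMap.codRestrict S.dom hf
  have hg : ∀ e, FormSpace.subtypeL h (g e) = f e := fun _ => rfl
  have hcont : Continuous g := by
    -- The graph is closed because a limit in the form norm is also a limit in `X`, where limits are
    -- unique.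
    refine g.continuous_of_seq_closed_graph fun u e y hu hy => ?_
    refine FormSpace.subtypeL_injective h ?_
    refine tendsto_nhds_unique (((FormSpace.subtypeL h).continuous.tendsto y).comp hy) ?_
    exact (f.continuous.tendsto e).comp hu
  obtain ⟨C, hC, hb⟩ := (⟨g, hcont⟩ : E →L[ℂ] FormSpace h).bound
  refine ⟨(1 + lam) * C ^ 2, by positivity, fun e => ?_⟩
  refine (FormSpace.abs_toFun_le h hσ hlam _).trans ?_
  have h1 : FormSpace.norm h ⟨f e, hf e⟩ ≤ C * ‖e‖ := hb e
  rw [mul_assoc, ← mul_pow]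
  have h0 : 0 ≤ FormSpace.norm h ⟨f e, hf e⟩ := apply_nonneg _ _
  gcongr

end RealQuadraticForm

/-! ### The inclusion and the bound -/

theorem proposition3p2 {X U Y : Type*}
    [NormedAddCommGroup X] [InnerProductSpace ℂ X] [CompleteSpace X]
    [NormedAddCommGroup U] [InnerProductSpace ℂ U] [CompleteSpace U]
    [NormedAddCommGroup Y] [InnerProductSpace ℂ Y] [CompleteSpace Y]
    (N : SystemNode X U Y)
    (Q : Y →L[ℂ] Y) (S : U →L[ℂ] Y) (R : U →L[ℂ] U)
    (hQ : IsSelfAdjoint Q) (hR : IsSelfAdjoint R)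
    (𝒮 : RealQuadraticForm X)
    (hsemi : 𝒮.IsSemiBounded) (hclosed : 𝒮.IsClosedForm) (hdense : 𝒮.IsDenselyDefined)
    (hdiss : N.IsDissipative (supplyRate Q S R) 𝒮) :
    ∃ hV : ∀ x ∈ N.V, x ∈ 𝒮.dom,
      ∃ c : ℝ, 0 < c ∧ ∀ (x₀ : X) (hx₀ : x₀ ∈ N.V),
        |𝒮.toFun ⟨x₀, hV x₀ hx₀⟩| ≤ c * N.normV x₀ ^ 2 := by
  have hV : ∀ x ∈ N.V, x ∈ 𝒮.dom := by
    rintro x₀ ⟨u₀, h₀⟩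
    obtain ⟨x, u, y, htraj, rfl⟩ := N.exists_isClassicalTrajectory h₀ 1
    exact (hdiss 1 one_pos x u y htraj).1
  refine ⟨hV, ?_⟩
  have : CompleteSpace N.AB.graph :=
    (show IsClosed (N.AB.graph : Set ((X × U) × X)) from N.closed_AB).completeSpace_coe
  let f : N.AB.graph →L[ℂ] X :=
    (ContinuousLinearMap.fst ℂ X U ∘L ContinuousLinearMap.fst ℂ (X × U) X) ∘L N.AB.graph.subtypeL
  obtain ⟨c, hc, hb⟩ := hclosed.exists_abs_toFun_le f fun e =>
    hV _ ⟨_, N.AB.mem_domain_of_mem_graph (y := e.1.2) e.2⟩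
  refine ⟨c, hc, fun x₀ hx₀ => ?_⟩
  -- The estimate is put in square-root form because `normV` is an infimum of norms, not of their
  -- squares.
  have hle : √(|𝒮.toFun ⟨x₀, hV x₀ hx₀⟩| / c) ≤ N.normV x₀ := by
    obtain ⟨u₀, h₀⟩ := id hx₀
    refine le_csInf ⟨_, u₀, h₀, rfl⟩ ?_
    rintro _ ⟨u, hu, rfl⟩
    refine Real.sqrt_le_iff.2 ⟨Real.sqrt_nonneg _, ?_⟩
    rw [div_le_iff₀' hc]
    refine (hb ⟨_, N.AB.mem_graph ⟨(x₀, u), hu⟩⟩).trans ?_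
    gcongr
    -- The graph carries the maximum norm of the product, which the Hilbert-type graph norm
    -- dominates.
    exact norm_le_graphNorm N.AB ⟨(x₀, u), hu⟩
  rw [← div_le_iff₀' hc, ← Real.sq_sqrt (show 0 ≤ |𝒮.toFun ⟨x₀, hV x₀ hx₀⟩| / c by positivity)]
  gcongr
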